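/- Let $N\ge 2$ be an integer with $N=2k$, let $\omega_{N-1}$ denote the area of the unit sphere of $\mathbb{R}^N$, and put $$c_N=\frac{\omega_{N-1}}{N}\binom{N}{k},\qquad \mu_N=N\Big[\frac{\omega_{N-1}}{k}\binom{N-1}{k-1}\Big]^{2/N}.$$ Let $X_1$ be the space of all locally absolutely continuous functions $v:(0,1)\to\mathbb{R}$ such that $\lim_{r\to1}v(r)=0$, $\int_0^1 r^{N-k}|v'|^{k+1}\,dr<\infty$ and $\int_0^1 r^{N-1}|v|^{k+1}\,dr<\infty$, with the norm $$\|v\|_{X_1}=\Big(c_N\int_0^1 r^{N-k}|v'|^{k+1}\,dr\Big)^{1/(k+1)}.$$ Let $f:[0,1)\to[0,\infty)$ be continuous with $f(0)=0$ and $f>0$ on $(0,1)$, and assume that there is $\sigma>1$ such that $$\limsup_{r\to0^+} f(r)\,|\ln r|^{\sigma}<\infty.$$ For $\beta\in\mathbb{R}$ put $$\mathcal{MT}_N(f;\beta)=\sup_{v\in X_1,\ \|v\|_{X_1}=1}\int_0^1 r^{N-1}e^{\beta|v(r)|^{\frac{N+2}{N}+f(r)}}\,dr\in[0,\infty].$$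 Then: (i) For every $\beta>0$ and every $v\in X_1$, $\displaystyle\int_0^1 r^{N-1}e^{\beta|v(r)|^{\frac{N+2}{N}+f(r)}}\,dr<\infty$. (ii) If $\beta\le\mu_N$, then $\mathcal{MT}_N(f;\beta)<\infty$. (iii) If $\beta>\mu_N$, then $\mathcal{MT}_N(f;\beta)=\infty$. -/

import Mathlib

open MeasureTheory Set Filter Topology

noncomputable section

/-- `ω_{N-1}`, the surface area of the unit sphere of `ℝ^N`. -/
def sphereArea (N : ℕ) : ℝ :=
  (volume : Measure (EuclideanSpace ℝ (Fin N))).toSphere.real univ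

/-- The critical constant `μ_N = N [ (ω_{N-1} / k) * binom (N-1) (k-1) ]^(2/N)`. -/
def criticalConst (N k : ℕ) : ℝ :=
  N * (sphereArea N / k * ((N - 1).choose (k - 1) : ℝ)) ^ ((2 : ℝ) / N)

/-- The normalising constant `c_N = ω_{N-1} * binom N k / N`. -/
def normConst (N k : ℕ) : ℝ :=
  sphereArea N * (N.choose k : ℝ) / N

/-- `v` is locally absolutely continuous on the open interval `(0, 1)`: it is absolutely
continuous on every compact subinterval. -/
def IsACLocUnit (v : ℝ → ℝ) : Prop :=
  ∀ a b : ℝ, 0 < a → a ≤ b → b < 1 → AbsolutelyContinuousOnInterval v a b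

/-- The weighted Sobolev space `X_1` (for `1 ≤ k ≤ N`, so that the natural number
differences below do not truncate). Its elements are functions on `(0, 1)`: the values of
`v : ℝ → ℝ` outside `(0, 1)` play no role. -/
structure IsX1 (N k : ℕ) (v : ℝ → ℝ) : Prop where
  ac : IsACLocUnit v
  tendsto_zero : Tendsto v (𝓝[<] 1) (𝓝 0)
  integrable_deriv : IntegrableOn (fun r : ℝ => r ^ (N - k) * |deriv v r| ^ (k + 1)) (Ioo 0 1)
  integrable_self : IntegrableOn (fun r : ℝ => r ^ (N - 1) * |v r| ^ (k + 1)) (Ioo 0 1)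

/-- The norm `‖v‖_{X_1} = ( c_N ∫_0^1 r^(N-k) |v'|^(k+1) dr )^(1/(k+1))`. -/
def X1norm (N k : ℕ) (v : ℝ → ℝ) : ℝ :=
  (normConst N k * ∫ r in Ioo (0 : ℝ) 1, r ^ (N - k) * |deriv v r| ^ (k + 1)) ^
    ((1 : ℝ) / ((k : ℝ) + 1))

/-- The integral `∫_0^1 r^(N-1) exp (β |v|^((N+2)/N + f(r))) dr`, with values in `[0, ∞]`. -/
def expIntegral (N : ℕ) (f : ℝ → ℝ) (β : ℝ) (v : ℝ → ℝ) : ENNReal :=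
  ∫⁻ r in Ioo (0 : ℝ) 1,
    ENNReal.ofReal (r ^ (N - 1) * Real.exp (β * |v r| ^ (((N : ℝ) + 2) / N + f r)))

/-- The supremum of `expIntegral N f β v` over all `v` in `X_1` with `‖v‖_{X_1} = 1`,
with values in `[0, ∞]`. -/
def moserTrudingerSup (N k : ℕ) (f : ℝ → ℝ) (β : ℝ) : ENNReal :=
  ⨆ v ∈ {v : ℝ → ℝ | IsX1 N k v ∧ X1norm N k v = 1}, expIntegral N f β v

end

/-! Put `p = (k + 1) / k = (N + 2) / N`, `n = N = 2k` and `t = -n log r`. Hölder's inequality bounds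
`|v r| ^ p` by `-log r` times the `1/k`-th power of the energy on `(r, 1)`; since `μ_N = n * c_N ^
(1/k)`, unit norm gives `μ_N |v| ^ p ≤ t`. As `r ^ (N-1) dr` is `exp (-t) dt / n` up to orientation,
the critical case is Moser's borderline inequality, and the pointwise bound alone just fails to
prove it.

What saves it is a gap estimate (`superlevel_gap`). If the deficit `t - μ_N |v| ^ p` is at most
`lam` at some large `t₁`, almost all the energy is spent on `(r₁, 1)`, with `t₁ = -n log r₁`; the
function then grows too slowly to have a small deficit again far beyond `t₁`. So the set of deficit
at most `lam` has length `O(lam)` in `t`, and summing `exp (-m)` over integer levels gives a uniform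
bound (`exists_lintegral_exp_rpow_le`).

The term `f` is harmless: `|v|` is at most a power of `|log r|`, so decay of `f` faster than `1 /
|log r|` changes `|v| ^ p` by a bounded amount (`exists_rpow_add_le`). For a single `v` the energy
near `0` is arbitrarily small, so every `β` is allowed (`exists_mul_rpow_le_log_add`). Above `μ_N`,
normalised truncated logarithms make the integral blow up. -/

/-! ### The gap estimate for points of small deficit -/

/-- Here `E` is the energy spent up to `t₁`, `e` the energy spent between `t₁` and `t₂`, and `B` the
Hölder bound for the increment. A small deficit at `t₁` forces `e ≤ k * lam / t₁`, and convexity of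
`x ^ p` then separates `u₁` from `B`. -/
theorem superlevel_gap {k : ℕ} (hk : 1 ≤ k) {u₁ u₂ B E e t₁ t₂ lam : ℝ} (hu₁ : 0 ≤ u₁)
    (hu₂ : 0 ≤ u₂) (hB : 0 ≤ B) (hE : 0 ≤ E) (he : 0 ≤ e) (hEe : E + e ≤ 1) (hlam : 0 < lam)
    (ht₁ : 2 ^ (k + 1) * k * lam ≤ t₁) (ht : t₁ ≤ t₂)
    (hu₁E : u₁ ^ ((k + 1 : ℝ) / k) ≤ t₁ * E ^ (1 / (k : ℝ)))
    (hu₁lam : t₁ - lam ≤ u₁ ^ ((k + 1 : ℝ) / k))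
    (hu : u₂ ≤ u₁ + B) (hBe : B ^ ((k + 1 : ℝ) / k) = (t₂ - t₁) * e ^ (1 / (k : ℝ)))
    (hu₂lam : t₂ - lam ≤ u₂ ^ ((k + 1 : ℝ) / k)) :
    t₂ - t₁ ≤ 2 * (1 + 2 ^ (k + 1) * k) * lam := by
  have hk0 : (0 : ℝ) < k := by exact_mod_cast hk
  have hk1 : (1 : ℝ) ≤ k := by exact_mod_cast hk
  set p : ℝ := (k + 1 : ℝ) / k with hp
  have hp1 : p = 1 + 1 / k := by rw [hp]; field_simp
  have hp_one : 1 ≤ p := by 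
    have : 0 < 1 / (k : ℝ) := by positivity
    linarith
  have ht₁0 : 0 < t₁ := lt_of_lt_of_le (by positivity) ht₁
  set δ : ℝ := k * lam / t₁ with hδ
  have hδ0 : 0 < δ := by positivity
  have hδt : δ * t₁ = k * lam := by rw [hδ]; field_simp
  have hδ1 : 2 ^ (k + 1) * δ ≤ 1 := by
    rw [hδ, ← mul_div_assoc, div_le_one ht₁0]; linarith
  -- The convexity weight: `s ^ (1/k) = 2 δ ^ (1/k)`, so the increment will cost at most half of `t₂
  -- - t₁`, which the left side absorbs. The threshold on `t₁` is what makes `s ≤ 1/2`.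
  set s : ℝ := 2 ^ k * δ with hs
  have hs0 : 0 < s := by positivity
  have hs2 : s ≤ 1 / 2 := by rw [hs]; rw [pow_succ] at hδ1; linarith
  have hlamt : lam ≤ t₁ := by
    have : (1 : ℝ) ≤ 2 ^ (k + 1) * k := by
      have : (1 : ℝ) ≤ 2 ^ (k + 1) := one_le_pow₀ (by norm_num)
      nlinarith
    nlinarith
  have hE1 : E ≤ 1 := by linarith
  have hEpow : 1 - lam / t₁ ≤ E ^ (1 / (k : ℝ)) := by
    have : (t₁ - lam) / t₁ ≤ E ^ (1 / (k : ℝ)) := by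
      rw [div_le_iff₀ ht₁0]; linarith
    rwa [sub_div, div_self ht₁0.ne'] at this
  have hdiv : lam / t₁ ≤ 1 := (div_le_one ht₁0).2 hlamt
  -- Bernoulli's inequality, after raising the bound on `E ^ (1/k)` to the power `k`.
  have hElow : 1 - δ ≤ E := by
    have h1 : (1 - lam / t₁) ^ k ≤ E := by
      calc (1 - lam / t₁) ^ k ≤ (E ^ (1 / (k : ℝ))) ^ k :=
            pow_le_pow_left₀ (by linarith) hEpow k
        _ = E := by
            rw [← Real.rpow_natCast, ← Real.rpow_mul hE, one_div_mul_cancel hk0.ne', Real.rpow_one]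
    have h2 := one_add_mul_le_pow (a := -(lam / t₁)) (by linarith) k
    have h3 : (k : ℝ) * -(lam / t₁) = -δ := by rw [hδ]; ring
    rw [h3, ← sub_eq_add_neg, ← sub_eq_add_neg] at h2
    linarith
  have heδ : e ≤ δ := by linarith
  have hu₁t : u₁ ^ p ≤ t₁ := by
    refine hu₁E.trans ?_
    have : E ^ (1 / (k : ℝ)) ≤ 1 := Real.rpow_le_one hE hE1 (by positivity)
    nlinarith
  have hs1 : 0 < 1 - s := by linarith
  have hscale : ∀ {w x : ℝ}, 0 < w → 0 ≤ x → w * (x / w) ^ p = x ^ p / w ^ (1 / (k : ℝ)) := by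
    intro w x hw hx
    rw [Real.div_rpow hx hw.le, hp1, Real.rpow_add hw, Real.rpow_one]
    field_simp
  have hjensen : (u₁ + B) ^ p ≤ (1 - s) * (u₁ / (1 - s)) ^ p + s * (B / s) ^ p := by
    have := (convexOn_rpow hp_one).2 (x := u₁ / (1 - s)) (y := B / s)
      (by simpa using by positivity) (by simpa using by positivity) hs1.le hs0.le (by ring)
    simp only [smul_eq_mul] at this
    rwa [mul_div_cancel₀ _ hs1.ne', mul_div_cancel₀ _ hs0.ne'] at this
  rw [hscale hs1 hu₁, hscale hs0 hB] at hjensen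
  have hfirst : u₁ ^ p / (1 - s) ^ (1 / (k : ℝ)) ≤ t₁ + 2 ^ (k + 1) * k * lam := by
    have h1 : 1 - s ≤ (1 - s) ^ (1 / (k : ℝ)) := by
      have := Real.rpow_le_rpow_of_exponent_ge hs1 (by linarith : 1 - s ≤ 1)
        (show 1 / (k : ℝ) ≤ 1 from (div_le_one hk0).2 hk1)
      simpa using this
    calc u₁ ^ p / (1 - s) ^ (1 / (k : ℝ)) ≤ t₁ / (1 - s) := by gcongr
      _ ≤ t₁ * (1 + 2 * s) := by
          rw [div_le_iff₀ hs1, mul_assoc]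
          refine le_mul_of_one_le_right ht₁0.le ?_
          nlinarith
      _ = t₁ + 2 ^ (k + 1) * (δ * t₁) := by rw [hs, pow_succ]; ring
      _ = _ := by rw [hδt]; ring
  have hsecond : B ^ p / s ^ (1 / (k : ℝ)) ≤ (t₂ - t₁) / 2 := by
    have h1 : s ^ (1 / (k : ℝ)) = 2 * δ ^ (1 / (k : ℝ)) := by
      rw [hs, Real.mul_rpow (by positivity) hδ0.le, ← Real.rpow_natCast 2 k,
        ← Real.rpow_mul (by norm_num), mul_one_div_cancel hk0.ne', Real.rpow_one]
    have h2 : e ^ (1 / (k : ℝ)) ≤ δ ^ (1 / (k : ℝ)) :=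
      Real.rpow_le_rpow he heδ (by positivity)
    have h3 : 0 < δ ^ (1 / (k : ℝ)) := Real.rpow_pos_of_pos hδ0 _
    rw [hBe, h1, div_le_iff₀ (by positivity)]
    have : (t₂ - t₁) / 2 * (2 * δ ^ (1 / (k : ℝ))) = (t₂ - t₁) * δ ^ (1 / (k : ℝ)) := by ring
    rw [this]
    exact mul_le_mul_of_nonneg_left h2 (by linarith)
  have hpow : u₂ ^ p ≤ (u₁ + B) ^ p := Real.rpow_le_rpow hu₂ hu (by linarith)
  nlinarith

/-! ### Pointwise bounds by the energy -/

theorem integrableOn_inv_Ioc {a b : ℝ} (ha : 0 < a) (hab : a ≤ b) :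
    IntegrableOn (fun x : ℝ => x⁻¹) (Ioc a b) := by
  rw [← intervalIntegrable_iff_integrableOn_Ioc_of_le hab]
  exact intervalIntegral.intervalIntegrable_inv (fun x hx => by
    rw [uIcc_of_le hab] at hx; exact (ha.trans_le hx.1).ne') continuousOn_id

/-- Hölder with exponents `k + 1` and `(k + 1) / k`, applied to `|v'| = (x ^ (k/(k+1)) |v'|) * x ^
(-k/(k+1))`: the second factor raised to its exponent is `1/x`, whence the logarithm. -/
theorem abs_sub_le_log_rpow_mul_energy {k : ℕ} (hk : 1 ≤ k) {v : ℝ → ℝ} {s r : ℝ} (hs : 0 < s)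
    (hsr : s ≤ r) (hv : AbsolutelyContinuousOnInterval v s r)
    (hint : IntegrableOn (fun x : ℝ => x ^ k * |deriv v x| ^ (k + 1)) (Ioc s r)) :
    |v r - v s| ≤ Real.log (r / s) ^ ((k : ℝ) / (k + 1)) *
      (∫ x in Ioc s r, x ^ k * |deriv v x| ^ (k + 1)) ^ (1 / ((k : ℝ) + 1)) := by
  have hk0 : (0 : ℝ) < k := by exact_mod_cast hk
  set P : ℝ := (k : ℝ) + 1 with hP
  set Q : ℝ := ((k : ℝ) + 1) / k with hQ
  have hPpos : 0 < P := by positivity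
  have hQpos : 0 < Q := by positivity
  have hconj : P.HolderConjugate Q := by
    rw [Real.holderConjugate_iff]
    refine ⟨by linarith, ?_⟩
    rw [hP, hQ]; field_simp; ring
  set F : ℝ → ℝ := fun x => x ^ ((k : ℝ) / (k + 1)) * |deriv v x|
  set G : ℝ → ℝ := fun x => x ^ (-((k : ℝ) / (k + 1)))
  have hmF : Measurable F := by
    have := measurable_deriv v
    fun_prop
  have hmG : Measurable G := by fun_prop
  have hFP : ∀ x ∈ Ioc s r, F x ^ P = x ^ k * |deriv v x| ^ (k + 1) := by
    intro x hx
    have hx0 : 0 < x := hs.trans hx.1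
    rw [Real.mul_rpow (by positivity) (abs_nonneg _), ← Real.rpow_mul hx0.le, hP,
      div_mul_cancel₀ _ hPpos.ne', Real.rpow_natCast]
    congr 1
    exact_mod_cast Real.rpow_natCast _ (k + 1)
  have hGQ : ∀ x ∈ Ioc s r, G x ^ Q = x⁻¹ := by
    intro x hx
    have hx0 : 0 < x := hs.trans hx.1
    rw [← Real.rpow_mul hx0.le, ← Real.rpow_neg_one]
    congr 1
    rw [hQ]; field_simp
  have hFG : ∀ x ∈ Ioc s r, F x * G x = |deriv v x| := by
    intro x hx
    have hx0 : 0 < x := hs.trans hx.1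
    simp only [F, G]
    rw [mul_right_comm, ← Real.rpow_add hx0]
    simp
  have hF0 : ∀ x ∈ Ioc s r, 0 ≤ F x := fun x hx => by
    have hx0 : 0 < x := hs.trans hx.1
    positivity
  have hG0 : ∀ x ∈ Ioc s r, 0 ≤ G x := fun x hx => by
    have hx0 : 0 < x := hs.trans hx.1
    positivity
  have hinv := integrableOn_inv_Ioc hs hsr
  have hF : MemLp F (ENNReal.ofReal P) (volume.restrict (Ioc s r)) := by
    rw [← integrable_norm_rpow_iff hmF.aestronglyMeasurable (by simpa using hPpos) (by simp),
      ENNReal.toReal_ofReal hPpos.le]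
    refine hint.congr ?_
    filter_upwards [ae_restrict_mem measurableSet_Ioc] with x hx
    rw [Real.norm_of_nonneg (hF0 x hx), hFP x hx]
  have hG : MemLp G (ENNReal.ofReal Q) (volume.restrict (Ioc s r)) := by
    rw [← integrable_norm_rpow_iff hmG.aestronglyMeasurable (by simpa using hQpos) (by simp),
      ENNReal.toReal_ofReal hQpos.le]
    refine hinv.congr ?_
    filter_upwards [ae_restrict_mem measurableSet_Ioc] with x hx
    rw [Real.norm_of_nonneg (hG0 x hx), hGQ x hx]
  have hmain := integral_mul_le_Lp_mul_Lq_of_nonneg hconj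
    ((ae_restrict_iff' measurableSet_Ioc).2 (ae_of_all _ hF0))
    ((ae_restrict_iff' measurableSet_Ioc).2 (ae_of_all _ hG0)) hF hG
  rw [setIntegral_congr_fun measurableSet_Ioc hFG, setIntegral_congr_fun measurableSet_Ioc hFP,
    setIntegral_congr_fun measurableSet_Ioc hGQ] at hmain
  have hlog : ∫ x in Ioc s r, x⁻¹ = Real.log (r / s) := by
    rw [← intervalIntegral.integral_of_le hsr, integral_inv_of_pos hs (hs.trans_le hsr)]
  rw [hlog, mul_comm] at hmain
  have hQ' : 1 / Q = (k : ℝ) / (k + 1) := by rw [hQ]; simp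
  rw [hQ'] at hmain
  refine le_trans ?_ hmain
  rw [← hv.integral_deriv_eq_sub, intervalIntegral.integral_of_le hsr]
  exact abs_integral_le_integral_abs

theorem abs_le_log_rpow_mul_energy {k : ℕ} (hk : 1 ≤ k) {v : ℝ → ℝ} (hac : IsACLocUnit v)
    (hlim : Tendsto v (𝓝[<] 1) (𝓝 0))
    (hint : IntegrableOn (fun x : ℝ => x ^ k * |deriv v x| ^ (k + 1)) (Ioo 0 1)) {r : ℝ}
    (hr : r ∈ Ioo (0 : ℝ) 1) :
    |v r| ≤ (-Real.log r) ^ ((k : ℝ) / (k + 1)) *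
      (∫ x in Ioo r 1, x ^ k * |deriv v x| ^ (k + 1)) ^ (1 / ((k : ℝ) + 1)) := by
  have hlim' : Tendsto (fun s => |v s - v r|) (𝓝[<] 1) (𝓝 |v r|) := by
    have := (hlim.sub_const (v r)).abs
    simpa using this
  refine le_of_tendsto hlim' ?_
  filter_upwards [Ioo_mem_nhdsLT hr.2] with s hs
  have hs0 : 0 < s := hr.1.trans hs.1
  have hsub : Ioc r s ⊆ Ioo r 1 := fun x hx => ⟨hx.1, hx.2.trans_lt hs.2⟩
  have hint' : IntegrableOn (fun x : ℝ => x ^ k * |deriv v x| ^ (k + 1)) (Ioo r 1) :=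
    hint.mono_set fun x hx => ⟨hr.1.trans hx.1, hx.2⟩
  have hnn : ∀ x ∈ Ioo r 1, 0 ≤ x ^ k * |deriv v x| ^ (k + 1) := fun x hx => by
    have : 0 < x := hr.1.trans hx.1
    positivity
  refine (abs_sub_le_log_rpow_mul_energy hk hr.1 hs.1.le (hac r s hr.1 hs.1.le hs.2)
    (hint'.mono_set hsub)).trans ?_
  have hlog : 0 ≤ Real.log (s / r) := Real.log_nonneg ((one_le_div hr.1).2 hs.1.le)
  have hlog' : Real.log (s / r) ≤ -Real.log r := by
    rw [Real.log_div hs0.ne' hr.1.ne']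
    have := Real.log_nonpos hs0.le hs.2.le
    linarith
  have h0 : 0 ≤ ∫ x in Ioc r s, x ^ k * |deriv v x| ^ (k + 1) :=
    setIntegral_nonneg measurableSet_Ioc fun x hx => hnn x (hsub hx)
  have hmono : ∫ x in Ioc r s, x ^ k * |deriv v x| ^ (k + 1) ≤
      ∫ x in Ioo r 1, x ^ k * |deriv v x| ^ (k + 1) :=
    setIntegral_mono_set hint'
      ((ae_restrict_iff' measurableSet_Ioo).2 (ae_of_all _ hnn)) hsub.eventuallyLE
  exact mul_le_mul (Real.rpow_le_rpow hlog hlog' (by positivity))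
    (Real.rpow_le_rpow h0 hmono (by positivity)) (Real.rpow_nonneg h0 _)
    (Real.rpow_nonneg (hlog.trans hlog') _)

/-- The critical pointwise bound for functions of finite energy that vanish at `1`. -/
theorem abs_le_log_rpow_mul_total_energy {k : ℕ} (hk : 1 ≤ k) {v : ℝ → ℝ} (hac : IsACLocUnit v)
    (hlim : Tendsto v (𝓝[<] 1) (𝓝 0))
    (hint : IntegrableOn (fun x : ℝ => x ^ k * |deriv v x| ^ (k + 1)) (Ioo 0 1)) {r : ℝ}
    (hr : r ∈ Ioo (0 : ℝ) 1) :
    |v r| ≤ (-Real.log r) ^ ((k : ℝ) / (k + 1)) *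
      (∫ x in Ioo (0 : ℝ) 1, x ^ k * |deriv v x| ^ (k + 1)) ^ (1 / ((k : ℝ) + 1)) := by
  have hlog : 0 ≤ -Real.log r := by linarith [Real.log_nonpos hr.1.le hr.2.le]
  have hnn : ∀ x ∈ Ioo (0 : ℝ) 1, 0 ≤ x ^ k * |deriv v x| ^ (k + 1) := fun x hx => by
    have : 0 < x := hx.1
    positivity
  have hsub : Ioo r 1 ⊆ Ioo 0 1 := Ioo_subset_Ioo_left hr.1.le
  refine (abs_le_log_rpow_mul_energy hk hac hlim hint hr).trans
    (mul_le_mul_of_nonneg_left ?_ (by positivity))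
  refine Real.rpow_le_rpow
    (setIntegral_nonneg measurableSet_Ioo fun x hx => hnn x (hsub hx)) ?_ (by positivity)
  exact setIntegral_mono_set hint ((ae_restrict_iff' measurableSet_Ioo).2 (ae_of_all _ hnn))
    hsub.eventuallyLE

/-! ### Moser's inequality at the critical exponent -/

theorem setLIntegral_inv_Icc {a b : ℝ} (ha : 0 < a) (hab : a ≤ b) :
    ∫⁻ x in Icc a b, ENNReal.ofReal x⁻¹ = ENNReal.ofReal (Real.log b - Real.log a) := by
  have hb : 0 < b := ha.trans_le hab
  have hint := integrableOn_inv_Ioc ha hab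
  rw [setLIntegral_congr Ioc_ae_eq_Icc.symm, ← ofReal_integral_eq_lintegral_ofReal hint,
    ← intervalIntegral.integral_of_le hab, integral_inv_of_pos ha hb,
    Real.log_div hb.ne' ha.ne']
  filter_upwards [ae_restrict_mem measurableSet_Ioc] with x hx
  exact inv_nonneg.2 (ha.trans hx.1).le

/-- The pair `u`, `D` behaves like the modulus of a function and the energy that it carries on
`(r, 1)`, both normalised so that the critical constant becomes `1`. -/
structure EnergyControlled (k : ℕ) (n : ℝ) (u D : ℝ → ℝ) : Prop where
  nonneg : ∀ r ∈ Ioo (0 : ℝ) 1, 0 ≤ u r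
  energy_nonneg : ∀ r ∈ Ioo (0 : ℝ) 1, 0 ≤ D r
  energy_le_one : ∀ r ∈ Ioo (0 : ℝ) 1, D r ≤ 1
  energy_anti : ∀ s r, 0 < s → s ≤ r → r < 1 → D r ≤ D s
  le_energy : ∀ r ∈ Ioo (0 : ℝ) 1,
    u r ≤ (n * -Real.log r) ^ ((k : ℝ) / (k + 1)) * D r ^ (1 / ((k : ℝ) + 1))
  le_add_energy : ∀ s r, 0 < s → s ≤ r → r < 1 → u s ≤ u r +
    (n * (Real.log r - Real.log s)) ^ ((k : ℝ) / (k + 1)) * (D s - D r) ^ (1 / ((k : ℝ) + 1))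

/-- Turns a Hölder bound into one for the critical power, linear in the logarithm. -/
theorem rpow_mul_rpow_rpow_conj {k : ℕ} (hk : 1 ≤ k) {x y : ℝ} (hx : 0 ≤ x) (hy : 0 ≤ y) :
    (x ^ ((k : ℝ) / (k + 1)) * y ^ (1 / ((k : ℝ) + 1))) ^ ((k + 1 : ℝ) / k) =
      x * y ^ (1 / (k : ℝ)) := by
  have hk0 : (0 : ℝ) < k := by exact_mod_cast hk
  rw [Real.mul_rpow (by positivity) (by positivity), ← Real.rpow_mul hx, ← Real.rpow_mul hy]
  have h1 : (k : ℝ) / (k + 1) * ((k + 1) / k) = 1 := by field_simp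
  have h2 : 1 / ((k : ℝ) + 1) * ((k + 1) / k) = 1 / k := by field_simp
  rw [h1, h2, Real.rpow_one]

namespace EnergyControlled

variable {k : ℕ} {n : ℝ} {u D : ℝ → ℝ}

theorem rpow_le (h : EnergyControlled k n u D) (hk : 1 ≤ k) (hn : 0 < n) {r : ℝ}
    (hr : r ∈ Ioo (0 : ℝ) 1) :
    u r ^ ((k + 1 : ℝ) / k) ≤ (n * -Real.log r) * D r ^ (1 / (k : ℝ)) := by
  have hlog := Real.log_nonpos hr.1.le hr.2.le
  rw [← rpow_mul_rpow_rpow_conj hk (by nlinarith) (h.energy_nonneg r hr)]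
  exact Real.rpow_le_rpow (h.nonneg r hr) (h.le_energy r hr) (by positivity)

theorem log_gap (h : EnergyControlled k n u D) (hk : 1 ≤ k) (hn : 0 < n) {lam : ℝ}
    (hlam : 0 < lam) {s r : ℝ} (hs : 0 < s) (hsr : s ≤ r) (hr : r < 1)
    (hT : 2 ^ (k + 1) * k * lam ≤ n * -Real.log r)
    (hslam : n * -Real.log s - lam ≤ u s ^ ((k + 1 : ℝ) / k))
    (hrlam : n * -Real.log r - lam ≤ u r ^ ((k + 1 : ℝ) / k)) :
    n * (Real.log r - Real.log s) ≤ 2 * (1 + 2 ^ (k + 1) * k) * lam := by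
  have hrI : r ∈ Ioo (0 : ℝ) 1 := ⟨hs.trans_le hsr, hr⟩
  have hsI : s ∈ Ioo (0 : ℝ) 1 := ⟨hs, hsr.trans_lt hr⟩
  have hlog : Real.log s ≤ Real.log r := Real.log_le_log hs hsr
  have hanti := h.energy_anti s r hs hsr hr
  have hx : 0 ≤ n * (Real.log r - Real.log s) := mul_nonneg hn.le (by linarith)
  have := superlevel_gap hk (h.nonneg r hrI) (h.nonneg s hsI)
    (B := (n * (Real.log r - Real.log s)) ^ ((k : ℝ) / (k + 1)) *
      (D s - D r) ^ (1 / ((k : ℝ) + 1)))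
    (E := D r) (e := D s - D r) (t₂ := n * -Real.log s)
    (mul_nonneg (Real.rpow_nonneg hx _) (Real.rpow_nonneg (by linarith) _))
    (h.energy_nonneg r hrI) (by linarith) (by linarith [h.energy_le_one s hsI]) hlam hT
    (by nlinarith) (h.rpow_le hk hn hrI) hrlam (h.le_add_energy s r hs hsr hr)
    (by rw [rpow_mul_rpow_rpow_conj hk hx (by linarith)]; ring) hslam
  linarith

/-- Any two points of the superlevel set beyond the threshold `T` are within `A` of each other in
`log r`, so one such point `q` locates them all. Covering by intervals avoids any measurability
assumption on `u`. -/
theorem exists_superlevel_cover (h : EnergyControlled k n u D) (hk : 1 ≤ k) (hn : 0 < n)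
    {lam : ℝ} (hlam : 0 < lam) :
    ∃ J : Set ℝ, MeasurableSet J ∧
      (∀ r ∈ Ioo (0 : ℝ) 1, n * -Real.log r - lam ≤ u r ^ ((k + 1 : ℝ) / k) → r ∈ J) ∧
      ∫⁻ x in J, ENNReal.ofReal x⁻¹ ≤
        ENNReal.ofReal ((2 ^ (k + 1) * k + 4 * (1 + 2 ^ (k + 1) * k)) / n * lam) := by
  set T : ℝ := 2 ^ (k + 1) * k * lam with hTdef
  set A : ℝ := 2 * (1 + 2 ^ (k + 1) * k) * lam / n with hA
  have hT0 : 0 ≤ T := by positivity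
  have hA0 : 0 ≤ A := by positivity
  have hbase : ∫⁻ x in Icc (Real.exp (-(T / n))) 1, ENNReal.ofReal x⁻¹ =
      ENNReal.ofReal (T / n) := by
    have : 0 ≤ T / n := by positivity
    rw [setLIntegral_inv_Icc (Real.exp_pos _) (Real.exp_le_one_iff.2 (by linarith))]
    simp
  have hcover : ∀ r ∈ Ioo (0 : ℝ) 1, n * -Real.log r < T → r ∈ Icc (Real.exp (-(T / n))) 1 := by
    intro r hr hrT
    refine ⟨?_, hr.2.le⟩
    rw [← Real.le_log_iff_exp_le hr.1, neg_le, le_div_iff₀ hn]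
    linarith
  by_cases hS : ∃ r ∈ Ioo (0 : ℝ) 1, T ≤ n * -Real.log r ∧
      n * -Real.log r - lam ≤ u r ^ ((k + 1 : ℝ) / k)
  · obtain ⟨q, hq, hqT, hqlam⟩ := hS
    refine ⟨Icc (Real.exp (-(T / n))) 1 ∪ Icc (Real.exp (Real.log q - A)) (Real.exp (Real.log q + A)),
      measurableSet_Icc.union measurableSet_Icc, fun r hr hrlam => ?_, ?_⟩
    · rcases lt_or_ge (n * -Real.log r) T with hrT | hrT
      · exact Or.inl (hcover r hr hrT)
      · right
        rw [mem_Icc, ← Real.le_log_iff_exp_le hr.1, ← Real.log_le_iff_le_exp hr.1]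
        rcases le_total r q with hle | hle
        · have hgap := h.log_gap hk hn hlam hr.1 hle hq.2 hqT hrlam hqlam
          have hgap' : Real.log q - Real.log r ≤ A := by
            rw [hA, le_div_iff₀ hn]; linarith
          exact ⟨by linarith, by linarith [Real.log_le_log hr.1 hle]⟩
        · have hgap := h.log_gap hk hn hlam hq.1 hle hr.2 hrT hqlam hrlam
          have hgap' : Real.log r - Real.log q ≤ A := by
            rw [hA, le_div_iff₀ hn]; linarith
          exact ⟨by linarith [Real.log_le_log hq.1 hle], by linarith⟩
    · refine (lintegral_union_le _ _ _).trans ?_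
      rw [hbase, setLIntegral_inv_Icc (Real.exp_pos _) (Real.exp_le_exp.2 (by linarith)),
        Real.log_exp, Real.log_exp, ← ENNReal.ofReal_add (by positivity) (by linarith)]
      refine ENNReal.ofReal_le_ofReal (le_of_eq ?_)
      rw [hA, hTdef]; field_simp; ring
  · refine ⟨Icc (Real.exp (-(T / n))) 1, measurableSet_Icc, fun r hr hrlam => ?_, ?_⟩
    · exact hcover r hr (not_le.1 fun hrT => hS ⟨r, hr, hrT, hrlam⟩)
    · rw [hbase, hTdef]
      refine ENNReal.ofReal_le_ofReal ?_
      rw [div_mul_eq_mul_div]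
      gcongr
      have : (0 : ℝ) ≤ 4 * (1 + 2 ^ (k + 1) * k) := by positivity
      linarith

end EnergyControlled

/-- **Moser's inequality** at the critical exponent, in logarithmic form. -/
theorem exists_lintegral_exp_rpow_le {k : ℕ} (hk : 1 ≤ k) {n : ℝ} (hn : 0 < n) :
    ∃ K : ENNReal, K < ⊤ ∧ ∀ u D : ℝ → ℝ, EnergyControlled k n u D →
      ∫⁻ r in Ioo (0 : ℝ) 1,
        ENNReal.ofReal (r⁻¹ * Real.exp (u r ^ ((k + 1 : ℝ) / k) + n * Real.log r)) ≤ K := by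
  set C : ℝ := (2 ^ (k + 1) * k + 4 * (1 + 2 ^ (k + 1) * k)) / n with hC
  have hC0 : 0 ≤ C := by positivity
  refine ⟨∑' m : ℕ, ENNReal.ofReal (Real.exp (-m) * (C * (m + 1))), ?_, fun u D h => ?_⟩
  · have h1 := Real.summable_pow_mul_exp_neg_nat_mul 1 one_pos
    have h0 := Real.summable_pow_mul_exp_neg_nat_mul 0 one_pos
    have hsum : Summable fun m : ℕ => Real.exp (-m) * (C * (m + 1)) := by
      refine ((h1.add h0).mul_left C).congr fun m => ?_
      simp only [pow_one, pow_zero, neg_mul, one_mul]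
      ring
    exact lt_top_iff_ne_top.2 hsum.tsum_ofReal_ne_top
  · choose J hJm hJ hJint using fun m : ℕ =>
      h.exists_superlevel_cover hk hn (lam := (m : ℝ) + 1) (by positivity)
    have hmeas : ∀ m : ℕ, Measurable ((J m).indicator fun x : ℝ => ENNReal.ofReal x⁻¹) :=
      fun m => Measurable.indicator (by fun_prop) (hJm m)
    calc ∫⁻ r in Ioo (0 : ℝ) 1,
          ENNReal.ofReal (r⁻¹ * Real.exp (u r ^ ((k + 1 : ℝ) / k) + n * Real.log r))
        ≤ ∫⁻ r in Ioo (0 : ℝ) 1, ∑' m : ℕ, ENNReal.ofReal (Real.exp (-m)) *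
            (J m).indicator (fun x : ℝ => ENNReal.ofReal x⁻¹) r := by
          refine setLIntegral_mono' measurableSet_Ioo fun r hr => ?_
          set F : ℝ := n * -Real.log r - u r ^ ((k + 1 : ℝ) / k) with hF
          have hlog := Real.log_nonpos hr.1.le hr.2.le
          have hF0 : 0 ≤ F := by
            have h1 := h.rpow_le hk hn hr
            have h2 : D r ^ (1 / (k : ℝ)) ≤ 1 :=
              Real.rpow_le_one (h.energy_nonneg r hr) (h.energy_le_one r hr) (by positivity)
            have h3 : 0 ≤ n * -Real.log r := by nlinarith
            nlinarith
          -- The single term `m = ⌊F⌋₊` suffices: `F < m + 1` puts `r` in `J m`, and `m ≤ F` gives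
          -- `exp (-F) ≤ exp (-m)`.
          refine le_trans ?_ (ENNReal.le_tsum ⌊F⌋₊)
          have hmem : r ∈ J ⌊F⌋₊ := hJ _ r hr (by linarith [Nat.lt_floor_add_one F])
          rw [indicator_of_mem hmem, ← ENNReal.ofReal_mul (Real.exp_nonneg _), mul_comm]
          have hr0 : 0 ≤ r⁻¹ := inv_nonneg.2 hr.1.le
          gcongr
          linarith [Nat.floor_le hF0]
      _ = ∑' m : ℕ, ∫⁻ r in Ioo (0 : ℝ) 1, ENNReal.ofReal (Real.exp (-m)) *
            (J m).indicator (fun x : ℝ => ENNReal.ofReal x⁻¹) r :=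
          lintegral_tsum fun m => ((hmeas m).const_mul _).aemeasurable
      _ ≤ ∑' m : ℕ, ENNReal.ofReal (Real.exp (-m) * (C * (m + 1))) := by
          refine ENNReal.tsum_le_tsum fun m => ?_
          rw [lintegral_const_mul _ (hmeas m), ENNReal.ofReal_mul (Real.exp_nonneg _)]
          gcongr
          refine (setLIntegral_le_lintegral _ _).trans ?_
          rw [lintegral_indicator (hJm m)]
          exact hJint m

/-- The scaling factor is chosen so that the power `(k + 1) / k` of the rescaled modulus is `n * c ^
(1/k) * |v| ^ ((k + 1) / k)`, which carries exactly the critical constant when `n = N` and `c =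
c_N`. -/
theorem EnergyControlled.of_isACLocUnit {k : ℕ} (hk : 1 ≤ k) {n c : ℝ} (hn : 0 < n) (hc : 0 < c)
    {v : ℝ → ℝ} (hac : IsACLocUnit v) (hlim : Tendsto v (𝓝[<] 1) (𝓝 0))
    (hint : IntegrableOn (fun x : ℝ => x ^ k * |deriv v x| ^ (k + 1)) (Ioo 0 1))
    (hnorm : c * ∫ x in Ioo (0 : ℝ) 1, x ^ k * |deriv v x| ^ (k + 1) = 1) :
    EnergyControlled k n
      (fun r => n ^ ((k : ℝ) / (k + 1)) * c ^ (1 / ((k : ℝ) + 1)) * |v r|)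
      (fun r => c * ∫ x in Ioo r 1, x ^ k * |deriv v x| ^ (k + 1)) := by
  have hnn : ∀ x ∈ Ioo (0 : ℝ) 1, 0 ≤ x ^ k * |deriv v x| ^ (k + 1) := fun x hx => by
    have : 0 < x := hx.1
    positivity
  have hsub : ∀ {r : ℝ}, 0 ≤ r → Ioo r 1 ⊆ Ioo 0 1 := fun hr x hx => ⟨hr.trans_lt hx.1, hx.2⟩
  have hmono : ∀ s r : ℝ, 0 ≤ s → s ≤ r → ∫ x in Ioo r 1, x ^ k * |deriv v x| ^ (k + 1) ≤
      ∫ x in Ioo s 1, x ^ k * |deriv v x| ^ (k + 1) := fun s r hs hsr =>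
    setIntegral_mono_set (hint.mono_set (hsub hs))
      ((ae_restrict_iff' measurableSet_Ioo).2 (ae_of_all _ fun x hx => hnn x (hsub hs hx)))
      (Ioo_subset_Ioo_left hsr).eventuallyLE
  have hnonneg : ∀ r : ℝ, 0 ≤ r → 0 ≤ ∫ x in Ioo r 1, x ^ k * |deriv v x| ^ (k + 1) :=
    fun r hr => setIntegral_nonneg measurableSet_Ioo fun x hx => hnn x (hsub hr hx)
  have hsplit : ∀ s r : ℝ, 0 < s → s ≤ r → r < 1 →
      ∫ x in Ioc s r, x ^ k * |deriv v x| ^ (k + 1) =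
        (∫ x in Ioo s 1, x ^ k * |deriv v x| ^ (k + 1)) -
          ∫ x in Ioo r 1, x ^ k * |deriv v x| ^ (k + 1) := by
    intro s r hs hsr hr
    rw [eq_sub_iff_add_eq, ← setIntegral_union _ measurableSet_Ioo, Ioc_union_Ioo_eq_Ioo hsr hr]
    · exact hint.mono_set fun x hx => ⟨hs.trans hx.1, hx.2.trans_lt hr⟩
    · exact hint.mono_set (hsub (hs.le.trans hsr))
    · exact disjoint_left.2 fun x hx hx' => absurd hx'.1 (not_lt.2 hx.2)
  have hscale : ∀ {L E : ℝ}, 0 ≤ L → 0 ≤ E →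
      (n * L) ^ ((k : ℝ) / (k + 1)) * (c * E) ^ (1 / ((k : ℝ) + 1)) =
        n ^ ((k : ℝ) / (k + 1)) * c ^ (1 / ((k : ℝ) + 1)) *
          (L ^ ((k : ℝ) / (k + 1)) * E ^ (1 / ((k : ℝ) + 1))) := by
    intro L E hL hE
    rw [Real.mul_rpow hn.le hL, Real.mul_rpow hc.le hE]
    ring
  constructor
  · intro r _; positivity
  · intro r hr
    exact mul_nonneg hc.le (hnonneg r hr.1.le)
  · intro r hr
    refine le_of_le_of_eq ?_ hnorm
    exact mul_le_mul_of_nonneg_left (hmono 0 r le_rfl hr.1.le) hc.le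
  · intro s r hs hsr _
    exact mul_le_mul_of_nonneg_left (hmono s r hs.le hsr) hc.le
  · intro r hr
    rw [hscale (by linarith [Real.log_nonpos hr.1.le hr.2.le]) (hnonneg r hr.1.le)]
    exact mul_le_mul_of_nonneg_left (abs_le_log_rpow_mul_energy hk hac hlim hint hr)
      (by positivity)
  · intro s r hs hsr hr
    have hlog := Real.log_le_log hs hsr
    rw [← mul_sub, ← hsplit s r hs hsr hr, hscale (by linarith)
      (by rw [hsplit s r hs hsr hr]; linarith [hmono s r hs.le hsr]), ← mul_add]
    refine mul_le_mul_of_nonneg_left ?_ (by positivity)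
    have := abs_sub_le_log_rpow_mul_energy hk hs hsr (hac s r hs hsr hr)
      (hint.mono_set fun x hx => ⟨hs.trans hx.1, hx.2.trans_lt hr⟩)
    rw [Real.log_div (hs.trans_le hsr).ne' hs.ne'] at this
    have h3 := abs_sub_abs_le_abs_sub (v s) (v r)
    rw [abs_sub_comm] at h3
    linarith

/-! ### Perturbation of the exponent -/

theorem tendsto_rpow_mul_log_affine {σ : ℝ} (hσ : 1 < σ) (a b : ℝ) :
    Tendsto (fun L : ℝ => L ^ (1 - σ) * (b + a * Real.log L)) atTop (𝓝 0) := by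
  have h1 : Tendsto (fun L : ℝ => L ^ (1 - σ)) atTop (𝓝 0) := by
    have := tendsto_rpow_neg_atTop (y := σ - 1) (by linarith)
    simpa using this
  have h2 := (isLittleO_log_rpow_atTop (r := σ - 1) (by linarith)).tendsto_div_nhds_zero
  have h3 := (h1.mul_const b).add (h2.const_mul a)
  simp only [zero_mul, mul_zero, add_zero] at h3
  refine h3.congr' ?_
  filter_upwards [eventually_gt_atTop 0] with L hL
  have : L ^ (1 - σ) = (L ^ (σ - 1))⁻¹ := by rw [← Real.rpow_neg hL.le]; congr 1; ring
  rw [this]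
  ring

/-- A perturbation of the exponent that decays faster than `1 / |log r|` costs only an additive
constant below the critical growth. -/
theorem exists_rpow_add_le {f : ℝ → ℝ} (hf_cont : ContinuousOn f (Ico 0 1))
    (hf_pos : ∀ r ∈ Ioo (0 : ℝ) 1, 0 < f r) {σ : ℝ} (hσ : 1 < σ)
    (hf_limsup : limsup (fun r : ℝ => ((f r * |Real.log r| ^ σ : ℝ) : EReal)) (𝓝[>] (0 : ℝ)) < ⊤)
    {a b p : ℝ} (ha : 0 < a) (hp : 0 < p) (hap : a * p = 1) (hb : 0 < b) :
    ∃ K : ℝ, 0 ≤ K ∧ ∀ r ∈ Ioo (0 : ℝ) 1, ∀ x : ℝ, 0 ≤ x → x ≤ b * (-Real.log r) ^ a →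
      x ^ (p + f r) ≤ x ^ p + K := by
  obtain ⟨M₀, hM₀, -⟩ := EReal.lt_iff_exists_real_btwn.1 hf_limsup
  set M : ℝ := max M₀ 0
  have hM : 0 ≤ M := le_max_right _ _
  have hev : ∀ᶠ r in 𝓝[>] (0 : ℝ), f r * |Real.log r| ^ σ ≤ M := by
    filter_upwards [eventually_lt_of_limsup_lt hM₀] with r hr
    exact (EReal.coe_lt_coe_iff.1 hr).le.trans (le_max_left _ _)
  have hL : Tendsto (fun r : ℝ => -Real.log r) (𝓝[>] 0) atTop :=
    tendsto_neg_atBot_atTop.comp Real.tendsto_log_nhdsGT_zero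
  have hev₂ := hL.eventually
    (((tendsto_rpow_mul_log_affine hσ a (Real.log b)).eventually_le_const one_pos).and
      (eventually_ge_atTop (1 : ℝ)))
  obtain ⟨r₀, hr₀, hnear⟩ := mem_nhdsGT_iff_exists_Ioo_subset.1 (hev.and hev₂)
  rw [mem_Ioi] at hr₀
  -- The point where the profile `b * (-log r) ^ a` equals `1`. Beyond it `x ≤ 1` and a larger
  -- exponent only helps, so `f` need not be bounded near `1`; it is bounded on the compact `[r₀,
  -- r₁]`.
  set r₁ : ℝ := Real.exp (-(b⁻¹ ^ p))
  have hr₁ : r₁ < 1 := by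
    rw [Real.exp_lt_one_iff]
    have : 0 < b⁻¹ ^ p := Real.rpow_pos_of_pos (inv_pos.2 hb) _
    linarith
  obtain ⟨F, hF⟩ := (isCompact_Icc (a := r₀) (b := r₁)).bddAbove_image
    (hf_cont.mono fun x hx => ⟨hr₀.le.trans hx.1, hx.2.trans_lt hr₁⟩)
  set G₀ : ℝ := b * |Real.log r₀| ^ a
  refine ⟨max (b ^ p * (M * Real.exp M)) (G₀ ^ (p + F)), le_max_of_le_left (by positivity),
    fun r hr x hx0 hx => ?_⟩
  have hfr := hf_pos r hr
  have hlog : 0 ≤ -Real.log r := by linarith [Real.log_nonpos hr.1.le hr.2.le]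
  rcases le_total x 1 with hx1 | hx1
  · have h1 : x ^ (p + f r) ≤ x ^ p :=
      Real.rpow_le_rpow_of_exponent_ge_of_imp hx0 hx1 (by linarith) 
        (fun _ h => absurd h (by positivity))
    have h2 : 0 ≤ max (b ^ p * (M * Real.exp M)) (G₀ ^ (p + F)) :=
      le_max_of_le_left (by positivity)
    linarith
  · have hxpos : 0 < x := by linarith
    rcases lt_or_ge r r₀ with hrr | hrr
    · obtain ⟨h1, h2, h3⟩ := hnear ⟨hr.1, hrr⟩
      set L : ℝ := -Real.log r with hLdef
      have hL0 : 0 < L := by linarith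
      have habs : |Real.log r| = L := by
        rw [hLdef, abs_of_nonpos (by linarith)]
      rw [habs] at h1
      have hLσ : 0 < L ^ σ := Real.rpow_pos_of_pos hL0 _
      have hlogx : 0 ≤ Real.log x := Real.log_nonneg hx1
      have hlogx' : Real.log x ≤ Real.log b + a * Real.log L := by
        rw [← Real.log_rpow hL0, ← Real.log_mul hb.ne' (Real.rpow_pos_of_pos hL0 _).ne']
        exact Real.log_le_log hxpos hx
      set y : ℝ := f r * Real.log x with hy
      -- Here `σ > 1` enters: `f r` is at most `M * L ^ (-σ)` and `log x` is `O(log L)`, so `x ^ f r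
      -- - 1` is `O(1 / L)` and offsets `x ^ p ≤ b ^ p * L`.
      have hyL : y * L ≤ M := by
        have h4 : L ^ (1 - σ) * Real.log x ≤ 1 :=
          (mul_le_mul_of_nonneg_left hlogx' (Real.rpow_nonneg hL0.le _)).trans h2
        have h5 : y * L = (f r * L ^ σ) * (L ^ (1 - σ) * Real.log x) := by
          have : L = L ^ σ * L ^ (1 - σ) := by rw [← Real.rpow_add hL0]; simp
          rw [hy]
          calc f r * Real.log x * L = f r * Real.log x * (L ^ σ * L ^ (1 - σ)) := by rw [← this]
            _ = _ := by ring
        rw [h5]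
        calc (f r * L ^ σ) * (L ^ (1 - σ) * Real.log x) ≤ M * 1 := by
              gcongr
          _ = M := mul_one _
      have hy0 : 0 ≤ y := mul_nonneg hfr.le hlogx
      have hyM : y ≤ M := by nlinarith
      have hexp : x ^ f r = Real.exp y := by rw [Real.rpow_def_of_pos hxpos, mul_comm]
      -- Multiply `1 - exp (-y) ≤ y` by `exp y ≤ exp M`.
      have hexp' : Real.exp y - 1 ≤ y * Real.exp M := by
        have h6 := Real.add_one_le_exp (-y)
        have h7 : Real.exp (-y) * Real.exp y = 1 := by rw [← Real.exp_add]; simp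
        have h8 : Real.exp y ≤ Real.exp M := Real.exp_le_exp.2 hyM
        have h9 := Real.exp_pos y
        nlinarith
      have hxp : x ^ p ≤ b ^ p * L := by
        calc x ^ p ≤ (b * L ^ a) ^ p := Real.rpow_le_rpow hx0 hx hp.le
          _ = b ^ p * L := by
            rw [Real.mul_rpow hb.le (Real.rpow_nonneg hL0.le _), ← Real.rpow_mul hL0.le, hap,
              Real.rpow_one]
      have hkey : x ^ p * (x ^ f r - 1) ≤ b ^ p * (M * Real.exp M) := by
        rw [hexp]
        calc x ^ p * (Real.exp y - 1) ≤ (b ^ p * L) * (y * Real.exp M) := by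
              refine mul_le_mul hxp hexp' ?_ (by positivity)
              linarith [Real.add_one_le_exp y]
          _ = b ^ p * ((y * L) * Real.exp M) := by ring
          _ ≤ _ := by gcongr
      rw [Real.rpow_add hxpos]
      have := le_max_left (b ^ p * (M * Real.exp M)) (G₀ ^ (p + F))
      linarith
    · have hr1 : r ≤ r₁ := by
        have h1 : b⁻¹ ≤ (-Real.log r) ^ a := by
          rw [inv_le_iff_one_le_mul₀' hb]; linarith
        have h2 : b⁻¹ ^ p ≤ -Real.log r := by
          calc b⁻¹ ^ p ≤ ((-Real.log r) ^ a) ^ p := Real.rpow_le_rpow (by positivity) h1 hp.le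
            _ = -Real.log r := by rw [← Real.rpow_mul hlog, hap, Real.rpow_one]
        rw [← Real.log_le_iff_le_exp hr.1]
        linarith
      have hfF : f r ≤ F := hF (mem_image_of_mem _ ⟨hrr, hr1⟩)
      have hxG : x ≤ G₀ := by
        refine hx.trans ?_
        have : Real.log r₀ ≤ Real.log r := Real.log_le_log hr₀ hrr
        have h3 : -Real.log r ≤ |Real.log r₀| := by
          linarith [neg_abs_le (Real.log r₀)]
        simp only [G₀]
        gcongr
      have h4 : x ^ (p + f r) ≤ G₀ ^ (p + F) :=
        (Real.rpow_le_rpow_of_exponent_le hx1 (by linarith)).trans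
          (Real.rpow_le_rpow hx0 hxG (by linarith))
      have h5 := le_max_right (b ^ p * (M * Real.exp M)) (G₀ ^ (p + F))
      have h6 : 0 ≤ x ^ p := by positivity
      linarith

/-! ### Growth of a single function near the origin -/

theorem exists_energy_tail_le {g : ℝ → ℝ} (hint : IntegrableOn g (Ioo 0 1)) {η : ℝ}
    (hη : 0 < η) : ∃ q ∈ Ioo (0 : ℝ) 1, ∫ x in Ioc 0 q, g x ≤ η := by
  have hvol : Tendsto (fun q : ℝ => (volume.restrict (Ioo (0 : ℝ) 1)) (Ioc 0 q)) (𝓝[>] 0) (𝓝 0) := by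
    have h1 : Tendsto (fun q : ℝ => ENNReal.ofReal q) (𝓝[>] 0) (𝓝 0) := by
      have := (ENNReal.continuous_ofReal.tendsto 0).mono_left
        (nhdsWithin_le_nhds (a := (0 : ℝ)) (s := Ioi 0))
      simpa using this
    refine tendsto_of_tendsto_of_tendsto_of_le_of_le tendsto_const_nhds h1 (fun _ => zero_le) ?_
    intro q
    refine (Measure.restrict_apply_le _ _).trans ?_
    simp
  have hlim := HasFiniteIntegral.tendsto_setIntegral_nhds_zero hint.2 hvol
  obtain ⟨q, hq, hq1⟩ := ((hlim.eventually_le_const hη).and (Ioo_mem_nhdsGT one_pos)).exists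
  refine ⟨q, hq1, ?_⟩
  rwa [Measure.restrict_restrict measurableSet_Ioc, inter_eq_left.2] at hq
  exact fun x hx => ⟨hx.1, hx.2.trans_lt hq1.2⟩

theorem add_rpow_le_two_rpow_mul {x y p : ℝ} (hx : 0 ≤ x) (hy : 0 ≤ y) (hp : 1 ≤ p) :
    (x + y) ^ p ≤ 2 ^ (p - 1) * (x ^ p + y ^ p) := by
  lift x to NNReal using hx
  lift y to NNReal using hy
  exact_mod_cast NNReal.rpow_add_le_mul_rpow_add_rpow x y hp

/-- A function of finite energy grows slower than any multiple of the critical profile. -/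
theorem exists_mul_rpow_le_log_add {k : ℕ} (hk : 1 ≤ k) {v : ℝ → ℝ} (hac : IsACLocUnit v)
    (hlim : Tendsto v (𝓝[<] 1) (𝓝 0))
    (hint : IntegrableOn (fun x : ℝ => x ^ k * |deriv v x| ^ (k + 1)) (Ioo 0 1)) {β : ℝ}
    (hβ : 0 < β) :
    ∃ C : ℝ, ∀ r ∈ Ioo (0 : ℝ) 1, β * |v r| ^ ((k + 1 : ℝ) / k) ≤ C - Real.log r := by
  have hk0 : (0 : ℝ) < k := by exact_mod_cast hk
  set p : ℝ := (k + 1 : ℝ) / k with hp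
  have hp1 : 1 ≤ p := by rw [hp, one_le_div hk0]; linarith
  have hp0 : 0 < p := by linarith
  have hnn : ∀ x ∈ Ioo (0 : ℝ) 1, 0 ≤ x ^ k * |deriv v x| ^ (k + 1) := fun x hx => by
    have : 0 < x := hx.1
    positivity
  -- With energy at most `θ ^ k` on `(0, q]`, the increment from `q` has `p`-th power at most `-θ
  -- log r`; the factor `2 ^ (p - 1)` from splitting the power and `β` then cancel, leaving `-log r`
  -- with coefficient `1`.
  set θ : ℝ := (β * 2 ^ (p - 1))⁻¹ with hθ
  have hθ0 : 0 < θ := by positivity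
  obtain ⟨q, hq, hqη⟩ := exists_energy_tail_le hint (pow_pos hθ0 k)
  set I : ℝ := ∫ x in Ioo (0 : ℝ) 1, x ^ k * |deriv v x| ^ (k + 1)
  have hI : 0 ≤ I := setIntegral_nonneg measurableSet_Ioo hnn
  set W : ℝ := (-Real.log q) * I ^ (1 / (k : ℝ))
  have hlogq : 0 ≤ -Real.log q := by linarith [Real.log_nonpos hq.1.le hq.2.le]
  have hW : 0 ≤ W := by positivity
  have hfar : ∀ r ∈ Ioo (0 : ℝ) 1, q ≤ r → |v r| ^ p ≤ W := by
    intro r hr hqr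
    have h1 := Real.rpow_le_rpow (abs_nonneg _)
      (abs_le_log_rpow_mul_total_energy hk hac hlim hint hr) hp0.le
    rw [hp, rpow_mul_rpow_rpow_conj hk
      (by linarith [Real.log_nonpos hr.1.le hr.2.le]) hI, ← hp] at h1
    have h2 : -Real.log r ≤ -Real.log q := neg_le_neg (Real.log_le_log hq.1 hqr)
    exact h1.trans (mul_le_mul_of_nonneg_right h2 (by positivity))
  have hnear : ∀ r ∈ Ioo (0 : ℝ) 1, r ≤ q →
      |v r| ^ p ≤ 2 ^ (p - 1) * (W + -Real.log r * θ) := by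
    intro r hr hrq
    have h2 : 0 ≤ -Real.log r := by linarith [Real.log_nonpos hr.1.le hr.2.le]
    have hsub : Ioc r q ⊆ Ioc 0 q := Ioc_subset_Ioc_left hr.1.le
    have hsub' : Ioc 0 q ⊆ Ioo 0 1 := fun x hx => ⟨hx.1, hx.2.trans_lt hq.2⟩
    have h1 := abs_sub_le_log_rpow_mul_energy hk hr.1 hrq (hac r q hr.1 hrq hq.2)
      (hint.mono_set (hsub.trans hsub'))
    have h3 : 0 ≤ ∫ x in Ioc r q, x ^ k * |deriv v x| ^ (k + 1) :=
      setIntegral_nonneg measurableSet_Ioc fun x hx => hnn x (hsub' (hsub hx))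
    have h4 : ∫ x in Ioc r q, x ^ k * |deriv v x| ^ (k + 1) ≤ θ ^ k :=
      (setIntegral_mono_set (hint.mono_set hsub') ((ae_restrict_iff' measurableSet_Ioc).2
        (ae_of_all _ fun x hx => hnn x (hsub' hx))) hsub.eventuallyLE).trans hqη
    have h5 : 0 ≤ Real.log (q / r) := Real.log_nonneg ((one_le_div hr.1).2 hrq)
    have h6 : Real.log (q / r) ≤ -Real.log r := by
      rw [Real.log_div hq.1.ne' hr.1.ne']; linarith
    have h7 := Real.rpow_le_rpow (abs_nonneg _) h1 hp0.le
    rw [hp, rpow_mul_rpow_rpow_conj hk h5 h3, ← hp] at h7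
    have h8 : |v q - v r| ^ p ≤ -Real.log r * θ := by
      refine h7.trans (mul_le_mul h6 ?_ (Real.rpow_nonneg h3 _) h2)
      calc (∫ x in Ioc r q, x ^ k * |deriv v x| ^ (k + 1)) ^ (1 / (k : ℝ))
          ≤ (θ ^ k) ^ (1 / (k : ℝ)) := Real.rpow_le_rpow h3 h4 (by positivity)
        _ = θ := by
          rw [← Real.rpow_natCast, ← Real.rpow_mul hθ0.le, mul_one_div_cancel hk0.ne',
            Real.rpow_one]
    have h9 : |v r| ≤ |v q| + |v q - v r| := by
      have := abs_sub_abs_le_abs_sub (v r) (v q)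
      rw [abs_sub_comm] at this
      linarith
    calc |v r| ^ p ≤ (|v q| + |v q - v r|) ^ p := Real.rpow_le_rpow (abs_nonneg _) h9 hp0.le
      _ ≤ 2 ^ (p - 1) * (|v q| ^ p + |v q - v r| ^ p) :=
          add_rpow_le_two_rpow_mul (abs_nonneg _) (abs_nonneg _) hp1
      _ ≤ _ := by
          have := hfar q hq le_rfl
          gcongr
  have h2p : (1 : ℝ) ≤ 2 ^ (p - 1) := Real.one_le_rpow (by norm_num) (by linarith)
  refine ⟨β * 2 ^ (p - 1) * W, fun r hr => ?_⟩
  have hlog : Real.log r ≤ 0 := Real.log_nonpos hr.1.le hr.2.le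
  rcases le_total r q with hrq | hrq
  · calc β * |v r| ^ p ≤ β * (2 ^ (p - 1) * (W + -Real.log r * θ)) := by
          have := hnear r hr hrq
          gcongr
      _ = β * 2 ^ (p - 1) * W + -Real.log r * ((β * 2 ^ (p - 1)) * θ) := by ring
      _ = β * 2 ^ (p - 1) * W - Real.log r := by
          rw [hθ, mul_inv_cancel₀ (by positivity)]; ring
  · have h1 : β * |v r| ^ p ≤ β * W := by
      have := hfar r hr hrq
      gcongr
    have h2 : β * W ≤ β * 2 ^ (p - 1) * W := by
      have : β * W * 1 ≤ β * W * 2 ^ (p - 1) := by gcongr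
      linarith
    linarith

/-! ### Moser's concentrating functions -/

section TruncatedLog

/-- The logarithm truncated at `-log R`, the profile of Moser's concentrating sequence. -/
noncomputable def truncatedLog (A R r : ℝ) : ℝ := A * -Real.log (max r R)

variable {A R : ℝ}

/-- Supplies both the continuity and the absolute continuity of the truncated logarithm. -/
theorem lipschitzWith_log_max (hR : 0 < R) :
    LipschitzWith (Real.toNNReal R⁻¹) fun r : ℝ => Real.log (max r R) := by
  refine LipschitzWith.of_le_add_mul _ fun x y => ?_
  rw [Real.coe_toNNReal _ (by positivity), Real.dist_eq]
  have hx : 0 < max x R := hR.trans_le (le_max_right _ _)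
  have hy : 0 < max y R := hR.trans_le (le_max_right _ _)
  have h1 := Real.log_le_sub_one_of_pos (div_pos hx hy)
  rw [Real.log_div hx.ne' hy.ne'] at h1
  have h2 : max x R / max y R - 1 ≤ R⁻¹ * |x - y| := by
    have h3 : max x R / max y R - 1 = (max y R)⁻¹ * (max x R - max y R) := by field_simp
    have h4 : max x R - max y R ≤ |x - y| :=
      (le_abs_self _).trans (by simpa using abs_max_sub_max_le_max x R y R)
    rw [h3]
    calc (max y R)⁻¹ * (max x R - max y R) ≤ (max y R)⁻¹ * |x - y| := by gcongr
      _ ≤ R⁻¹ * |x - y| := by gcongr; exact le_max_right _ _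
  linarith

theorem continuous_truncatedLog (hR : 0 < R) : Continuous (truncatedLog A R) :=
  continuous_const.mul (lipschitzWith_log_max hR).continuous.neg

theorem deriv_truncatedLog_of_lt {r : ℝ} (hr : r < R) : deriv (truncatedLog A R) r = 0 := by
  have : truncatedLog A R =ᶠ[𝓝 r] fun _ => A * -Real.log R := by
    filter_upwards [Iio_mem_nhds hr] with x hx
    rw [truncatedLog, max_eq_right (le_of_lt hx)]
  rw [this.deriv_eq, deriv_const]

theorem deriv_truncatedLog_of_gt (hR : 0 < R) {r : ℝ} (hr : R < r) :
    deriv (truncatedLog A R) r = A * -r⁻¹ := by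
  have : truncatedLog A R =ᶠ[𝓝 r] fun x => A * -Real.log x := by
    filter_upwards [Ioi_mem_nhds hr] with x hx
    rw [truncatedLog, max_eq_left (le_of_lt hx)]
  rw [this.deriv_eq]
  exact (((Real.hasDerivAt_log (hR.trans hr).ne').neg).const_mul A).deriv

theorem energy_truncatedLog_ae_eq (k : ℕ) (hA : 0 ≤ A) (hR : 0 < R) :
    (fun x : ℝ => x ^ k * |deriv (truncatedLog A R) x| ^ (k + 1)) =ᵐ[volume.restrict (Ioo 0 1)]
      (Ioc R 1).indicator fun x => A ^ (k + 1) * x⁻¹ := by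
  have hne : ∀ᵐ x : ℝ ∂volume.restrict (Ioo (0 : ℝ) 1), x ≠ R :=
    ae_restrict_of_ae (by simp [ae_iff])
  filter_upwards [hne, ae_restrict_mem measurableSet_Ioo] with x hxR hx
  rcases lt_or_gt_of_ne hxR with h | h
  · rw [deriv_truncatedLog_of_lt h, indicator_of_notMem (fun h' => absurd h'.1 (not_lt.2 h.le))]
    simp
  · have hx0 : 0 < x := hx.1
    rw [deriv_truncatedLog_of_gt hR h, indicator_of_mem (show x ∈ Ioc R 1 from ⟨h, hx.2.le⟩),
      abs_mul, abs_neg, abs_of_nonneg hA, abs_of_pos (inv_pos.2 hx0), mul_pow,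
      inv_pow]
    field_simp
    ring

theorem integrableOn_indicator_inv (hR : 0 < R) (hR1 : R < 1) (c : ℝ) :
    IntegrableOn ((Ioc R 1).indicator fun x : ℝ => c * x⁻¹) (Ioo 0 1) := by
  rw [IntegrableOn, integrable_indicator_iff measurableSet_Ioc]
  refine Integrable.mono_measure ?_ (Measure.restrict_mono_measure Measure.restrict_le_self _)
  exact (integrableOn_inv_Ioc hR hR1.le).const_mul c

theorem isX1_truncatedLog {N k : ℕ} (hNk : N - k = k) (hA : 0 ≤ A) (hR : 0 < R) (hR1 : R < 1) :
    IsX1 N k (truncatedLog A R) := by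
  have hcont := continuous_truncatedLog (A := A) hR
  refine ⟨fun a b _ _ _ => ?_, ?_, ?_, ?_⟩
  · have := ((lipschitzWith_log_max hR).lipschitzOnWith
      (s := uIcc a b)).absolutelyContinuousOnInterval.neg.const_mul A
    exact this
  · have h := (hcont.tendsto 1).mono_left (nhdsWithin_le_nhds (s := Iio 1))
    simpa [truncatedLog, max_eq_left hR1.le] using h
  · rw [hNk]
    exact (integrableOn_indicator_inv hR hR1 _).congr (energy_truncatedLog_ae_eq k hA hR).symm
  · have : Continuous fun r : ℝ => r ^ (N - 1) * |truncatedLog A R r| ^ (k + 1) := by fun_prop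
    exact (this.integrableOn_Icc (a := 0) (b := 1)).mono_set Ioo_subset_Icc_self

theorem energy_truncatedLog {k : ℕ} (hA : 0 ≤ A) (hR : 0 < R) (hR1 : R < 1) :
    ∫ x in Ioo (0 : ℝ) 1, x ^ k * |deriv (truncatedLog A R) x| ^ (k + 1) =
      A ^ (k + 1) * -Real.log R := by
  rw [integral_congr_ae (energy_truncatedLog_ae_eq k hA hR), integral_indicator measurableSet_Ioc,
    Measure.restrict_restrict measurableSet_Ioc]
  have : (Ioc R 1 ∩ Ioo 0 1 : Set ℝ) = Ioo R 1 := by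
    ext x
    simp only [mem_inter_iff, mem_Ioc, mem_Ioo]
    exact ⟨fun h => ⟨h.1.1, h.2.2⟩, fun h => ⟨⟨h.1, h.2.le⟩, hR.trans h.1, h.2⟩⟩
  rw [this, ← integral_Ioc_eq_integral_Ioo, integral_const_mul,
    ← intervalIntegral.integral_of_le hR1.le, integral_inv_of_pos hR one_pos,
    Real.log_div one_ne_zero hR.ne']
  simp

end TruncatedLog

/-! ### The constants -/

section Constants

theorem sphereArea_pos {N : ℕ} (hN : 1 ≤ N) : 0 < sphereArea N := by
  have : Nonempty (Fin N) := ⟨⟨0, hN⟩⟩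
  have h1 : 0 < (volume : Measure (EuclideanSpace ℝ (Fin N))).real (Metric.ball 0 1) :=
    ENNReal.toReal_pos (Metric.measure_ball_pos _ _ one_pos).ne' measure_ball_lt_top.ne
  have h2 : (0 : ℝ) < N := by exact_mod_cast hN
  rw [sphereArea, Measure.toSphere_real_apply_univ, finrank_euclideanSpace_fin]
  positivity

variable {k : ℕ}

theorem normConst_pos (hk : 1 ≤ k) : 0 < normConst (2 * k) k := by
  have h1 := sphereArea_pos (N := 2 * k) (by omega)
  have h2 : 0 < (2 * k).choose k := Nat.choose_pos (by omega)
  have h3 : 0 < 2 * k := by omega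
  rw [normConst]
  positivity

/-- The identity `2k * binom (2k-1) (k-1) = k * binom (2k) k` identifies the bracket in `μ_N` with
`c_N`. -/
theorem criticalConst_eq (hk : 1 ≤ k) :
    criticalConst (2 * k) k = (2 * k : ℕ) * normConst (2 * k) k ^ (1 / (k : ℝ)) := by
  have hk0 : (0 : ℝ) < k := by exact_mod_cast hk
  have hchoose : (2 * k : ℝ) * ((2 * k - 1).choose (k - 1) : ℝ) = ((2 * k).choose k : ℝ) * k := by
    obtain ⟨m, rfl⟩ : ∃ m, k = m + 1 := ⟨k - 1, by omega⟩
    have := Nat.add_one_mul_choose_eq (2 * m + 1) m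
    exact_mod_cast this
  have hbase : sphereArea (2 * k) / k * ((2 * k - 1).choose (k - 1) : ℝ) =
      normConst (2 * k) k := by
    rw [normConst]
    have : 2 * ((2 * k - 1).choose (k - 1) : ℝ) = (2 * k).choose k :=
      mul_left_cancel₀ hk0.ne' (by linarith)
    push_cast
    field_simp
    linear_combination sphereArea (2 * k) * this
  rw [criticalConst, hbase]
  congr 2
  push_cast
  field_simp

end Constants

/-! ### The three assertions -/

section Main

variable {k : ℕ} {f : ℝ → ℝ} {σ : ℝ}

theorem rpow_conj_eq_one {k : ℕ} (hk : 1 ≤ k) : ((k : ℝ) / (k + 1)) * ((k + 1 : ℝ) / k) = 1 := by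
  have hk0 : (0 : ℝ) < k := by exact_mod_cast hk
  field_simp

theorem expIntegral_lt_top (hk : 1 ≤ k) (hf_cont : ContinuousOn f (Ico 0 1))
    (hf_pos : ∀ r ∈ Ioo (0 : ℝ) 1, 0 < f r) (hσ : 1 < σ)
    (hf_limsup : limsup (fun r : ℝ => ((f r * |Real.log r| ^ σ : ℝ) : EReal)) (𝓝[>] (0 : ℝ)) < ⊤)
    (hexp : (((2 * k : ℕ) : ℝ) + 2) / (2 * k : ℕ) = (k + 1 : ℝ) / k)
    {β : ℝ} (hβ : 0 < β) {v : ℝ → ℝ} (hv : IsX1 (2 * k) k v) :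
    expIntegral (2 * k) f β v < ⊤ := by
  have hk0 : (0 : ℝ) < k := by exact_mod_cast hk
  have hNk : 2 * k - k = k := by omega
  have hint := hv.integrable_deriv
  rw [hNk] at hint
  have hnn : ∀ x ∈ Ioo (0 : ℝ) 1, 0 ≤ x ^ k * |deriv v x| ^ (k + 1) := fun x hx => by
    have : 0 < x := hx.1
    positivity
  set I : ℝ := ∫ x in Ioo (0 : ℝ) 1, x ^ k * |deriv v x| ^ (k + 1)
  have hI : 0 ≤ I := setIntegral_nonneg measurableSet_Ioo hnn
  -- The `+ 1` keeps `b` positive when `v` has zero energy.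
  obtain ⟨K, -, hK⟩ := exists_rpow_add_le hf_cont hf_pos hσ hf_limsup
    (a := (k : ℝ) / (k + 1)) (b := I ^ (1 / ((k : ℝ) + 1)) + 1) (p := (k + 1 : ℝ) / k)
    (by positivity) (by positivity) (rpow_conj_eq_one hk) (by positivity)
  obtain ⟨C, hC⟩ := exists_mul_rpow_le_log_add hk hv.ac hv.tendsto_zero hint hβ
  have hbound : ∀ r ∈ Ioo (0 : ℝ) 1, r ^ (2 * k - 1) *
      Real.exp (β * |v r| ^ ((((2 * k : ℕ) : ℝ) + 2) / (2 * k : ℕ) + f r)) ≤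
        Real.exp (C + β * K) := by
    intro r hr
    have hlog : 0 ≤ -Real.log r := by linarith [Real.log_nonpos hr.1.le hr.2.le]
    have h1 : |v r| ≤ (I ^ (1 / ((k : ℝ) + 1)) + 1) * (-Real.log r) ^ ((k : ℝ) / (k + 1)) := by
      refine (abs_le_log_rpow_mul_total_energy hk hv.ac hv.tendsto_zero hint hr).trans ?_
      rw [mul_comm]
      exact mul_le_mul_of_nonneg_right (by linarith) (by positivity)
    have h2 := mul_le_mul_of_nonneg_left (hK r hr _ (abs_nonneg _) h1) hβ.le
    have h3 := hC r hr
    rw [hexp]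
    have h4 : Real.exp (β * |v r| ^ ((k + 1 : ℝ) / k + f r)) ≤ Real.exp (C + β * K) * r⁻¹ := by
      rw [← Real.exp_log (inv_pos.2 hr.1), Real.log_inv, ← Real.exp_add]
      exact Real.exp_le_exp.2 (by linarith)
    -- The weight supplies at least one factor `r`, which cancels the `r⁻¹` from the logarithmic
    -- growth bound.
    have h5 : r ^ (2 * k - 1) ≤ r :=
      pow_le_of_le_one hr.1.le hr.2.le (by omega)
    calc r ^ (2 * k - 1) * Real.exp (β * |v r| ^ ((k + 1 : ℝ) / k + f r))
        ≤ r * (Real.exp (C + β * K) * r⁻¹) :=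
          mul_le_mul h5 h4 (Real.exp_nonneg _) hr.1.le
      _ = Real.exp (C + β * K) := by
          rw [mul_left_comm, mul_inv_cancel₀ hr.1.ne', mul_one]
  refine (setLIntegral_mono' measurableSet_Ioo fun r hr =>
    ENNReal.ofReal_le_ofReal (hbound r hr)).trans_lt ?_
  rw [setLIntegral_const]
  simp

theorem moserTrudingerSup_lt_top (hk : 1 ≤ k) (hf_cont : ContinuousOn f (Ico 0 1))
    (hf_pos : ∀ r ∈ Ioo (0 : ℝ) 1, 0 < f r) (hσ : 1 < σ)
    (hf_limsup : limsup (fun r : ℝ => ((f r * |Real.log r| ^ σ : ℝ) : EReal)) (𝓝[>] (0 : ℝ)) < ⊤)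
    (hexp : (((2 * k : ℕ) : ℝ) + 2) / (2 * k : ℕ) = (k + 1 : ℝ) / k)
    {β : ℝ} (hβ : β ≤ criticalConst (2 * k) k) :
    moserTrudingerSup (2 * k) k f β < ⊤ := by
  have hk0 : (0 : ℝ) < k := by exact_mod_cast hk
  have hNk : 2 * k - k = k := by omega
  have hn : (0 : ℝ) < (2 * k : ℕ) := by push_cast; positivity
  set c : ℝ := normConst (2 * k) k with hcdef
  have hc : 0 < c := normConst_pos hk
  set μ : ℝ := criticalConst (2 * k) k with hμdef
  have hμ : μ = (2 * k : ℕ) * c ^ (1 / (k : ℝ)) := criticalConst_eq hk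
  have hμ0 : 0 < μ := by rw [hμ]; positivity
  obtain ⟨K, -, hK⟩ := exists_rpow_add_le hf_cont hf_pos hσ hf_limsup
    (a := (k : ℝ) / (k + 1)) (b := c⁻¹ ^ (1 / ((k : ℝ) + 1))) (p := (k + 1 : ℝ) / k)
    (by positivity) (by positivity) (rpow_conj_eq_one hk) (by positivity)
  obtain ⟨S, hS, hmoser⟩ := exists_lintegral_exp_rpow_le hk hn
  refine lt_of_le_of_lt (iSup₂_le fun v hv => ?_)
    (ENNReal.mul_lt_top (ENNReal.ofReal_lt_top (r := Real.exp (μ * K))) hS)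
  obtain ⟨hv, hnorm⟩ := hv
  have hint := hv.integrable_deriv
  rw [hNk] at hint
  have hnn : ∀ x ∈ Ioo (0 : ℝ) 1, 0 ≤ x ^ k * |deriv v x| ^ (k + 1) := fun x hx => by
    have : 0 < x := hx.1
    positivity
  set I : ℝ := ∫ x in Ioo (0 : ℝ) 1, x ^ k * |deriv v x| ^ (k + 1) with hIdef
  have hI : 0 ≤ I := setIntegral_nonneg measurableSet_Ioo hnn
  have hcI : c * I = 1 := by
    rw [X1norm, hNk] at hnorm
    exact (Real.rpow_left_inj (mul_nonneg hc.le hI) zero_le_one (by positivity)).1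
      (hnorm.trans (Real.one_rpow (1 / ((k : ℝ) + 1))).symm)
  have hctrl := EnergyControlled.of_isACLocUnit hk hn hc hv.ac hv.tendsto_zero hint hcI
  refine le_trans ?_ (mul_le_mul_right (hmoser _ _ hctrl) _)
  rw [expIntegral, ← lintegral_const_mul' _ _ ENNReal.ofReal_ne_top]
  refine setLIntegral_mono' measurableSet_Ioo fun r hr => ?_
  rw [← ENNReal.ofReal_mul (Real.exp_nonneg _)]
  refine ENNReal.ofReal_le_ofReal ?_
  have h1 : |v r| ≤ c⁻¹ ^ (1 / ((k : ℝ) + 1)) * (-Real.log r) ^ ((k : ℝ) / (k + 1)) := by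
    rw [← eq_inv_of_mul_eq_one_right hcI, mul_comm]
    exact abs_le_log_rpow_mul_total_energy hk hv.ac hv.tendsto_zero hint hr
  have h2 := hK r hr _ (abs_nonneg _) h1
  have hpow : ((2 * k : ℕ) ^ ((k : ℝ) / (k + 1)) * c ^ (1 / ((k : ℝ) + 1)) * |v r|) ^
      ((k + 1 : ℝ) / k) = μ * |v r| ^ ((k + 1 : ℝ) / k) := by
    rw [Real.mul_rpow (by positivity) (abs_nonneg _), rpow_mul_rpow_rpow_conj hk hn.le hc.le, hμ]
  rw [hpow, hexp]
  have h3 : β * |v r| ^ ((k + 1 : ℝ) / k + f r) ≤ μ * K + μ * |v r| ^ ((k + 1 : ℝ) / k) := by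
    -- Only `β ≤ μ` is needed to pass to the critical constant, so nonpositive `β` are included.
    calc β * |v r| ^ ((k + 1 : ℝ) / k + f r) ≤ μ * |v r| ^ ((k + 1 : ℝ) / k + f r) := by gcongr
      _ ≤ μ * (|v r| ^ ((k + 1 : ℝ) / k) + K) := by gcongr
      _ = _ := by ring
  have h4 : r ^ (2 * k - 1) = r⁻¹ * Real.exp ((2 * k : ℕ) * Real.log r) := by
    rw [Real.exp_nat_mul, Real.exp_log hr.1, eq_inv_mul_iff_mul_eq₀ hr.1.ne', ← pow_succ']
    congr 1
    omega
  have hr0 : 0 ≤ r⁻¹ := inv_nonneg.2 hr.1.le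
  calc r ^ (2 * k - 1) * Real.exp (β * |v r| ^ ((k + 1 : ℝ) / k + f r))
      ≤ r ^ (2 * k - 1) * Real.exp (μ * K + μ * |v r| ^ ((k + 1 : ℝ) / k)) :=
        mul_le_mul_of_nonneg_left (Real.exp_le_exp.2 h3) (pow_nonneg hr.1.le _)
    _ = _ := by rw [h4, Real.exp_add, Real.exp_add]; ring

/-- Only the plateau `(0, R)` is kept. Its height is at least `1`, so adding `f r > 0` to the
exponent can only increase the integrand. -/
theorem le_expIntegral_truncatedLog (hk : 1 ≤ k) (hf_pos : ∀ r ∈ Ioo (0 : ℝ) 1, 0 < f r)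
    (hexp : (((2 * k : ℕ) : ℝ) + 2) / (2 * k : ℕ) = (k + 1 : ℝ) / k)
    {β A R : ℝ} (hβ : 0 ≤ β) (hR : 0 < R) (hR1 : R < 1) (hA : 1 ≤ A * -Real.log R) :
    ENNReal.ofReal (R ^ (2 * k) / (2 * k : ℕ) *
      Real.exp (β * (A * -Real.log R) ^ ((k + 1 : ℝ) / k))) ≤
        expIntegral (2 * k) f β (truncatedLog A R) := by
  have hk0 : (0 : ℝ) < k := by exact_mod_cast hk
  set E : ℝ := Real.exp (β * (A * -Real.log R) ^ ((k + 1 : ℝ) / k))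
  have hE : 0 ≤ E := Real.exp_nonneg _
  calc ENNReal.ofReal (R ^ (2 * k) / (2 * k : ℕ) * E)
      = ∫⁻ r in Ioo (0 : ℝ) R, ENNReal.ofReal (r ^ (2 * k - 1) * E) := by
        have hint : IntegrableOn (fun r : ℝ => r ^ (2 * k - 1) * E) (Ioo 0 R) :=
          ((by fun_prop : Continuous fun r : ℝ => r ^ (2 * k - 1) * E).integrableOn_Icc).mono_set
            Ioo_subset_Icc_self
        rw [← ofReal_integral_eq_lintegral_ofReal hint, ← integral_Ioc_eq_integral_Ioo,
          ← intervalIntegral.integral_of_le hR.le, intervalIntegral.integral_mul_const,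
          integral_pow]
        · have h1 : 2 * k - 1 + 1 = 2 * k := by omega
          have h2 : ((2 * k - 1 : ℕ) : ℝ) + 1 = (2 * k : ℕ) := by exact_mod_cast h1
          rw [h1, h2, zero_pow (by omega), sub_zero]
        · filter_upwards [ae_restrict_mem measurableSet_Ioo] with r hr
          exact mul_nonneg (pow_nonneg hr.1.le _) hE
    _ ≤ ∫⁻ r in Ioo (0 : ℝ) R, ENNReal.ofReal (r ^ (2 * k - 1) * Real.exp (β *
          |truncatedLog A R r| ^ ((((2 * k : ℕ) : ℝ) + 2) / (2 * k : ℕ) + f r))) := by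
        refine setLIntegral_mono' measurableSet_Ioo fun r hr => ?_
        rw [hexp, truncatedLog, max_eq_right hr.2.le, abs_of_nonneg (by linarith)]
        refine ENNReal.ofReal_le_ofReal (mul_le_mul_of_nonneg_left ?_ (pow_nonneg hr.1.le _))
        refine Real.exp_le_exp.2 (mul_le_mul_of_nonneg_left ?_ hβ)
        refine Real.rpow_le_rpow_of_exponent_le hA ?_
        linarith [hf_pos r ⟨hr.1, hr.2.trans hR1⟩]
    _ ≤ _ := lintegral_mono_set (Ioo_subset_Ioo_right hR1.le)

theorem moserTrudingerSup_eq_top (hk : 1 ≤ k) (hf_pos : ∀ r ∈ Ioo (0 : ℝ) 1, 0 < f r)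
    (hexp : (((2 * k : ℕ) : ℝ) + 2) / (2 * k : ℕ) = (k + 1 : ℝ) / k)
    {β : ℝ} (hβ : criticalConst (2 * k) k < β) :
    moserTrudingerSup (2 * k) k f β = ⊤ := by
  have hk0 : (0 : ℝ) < k := by exact_mod_cast hk
  have hNk : 2 * k - k = k := by omega
  have hn : (0 : ℝ) < (2 * k : ℕ) := by push_cast; positivity
  set n : ℝ := ((2 * k : ℕ) : ℝ) with hndef
  set c : ℝ := normConst (2 * k) k with hcdef
  have hc : 0 < c := normConst_pos hk
  rw [criticalConst_eq hk] at hβ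
  have hβ0 : 0 < β := lt_trans (by positivity) hβ
  have hcinv : c ^ (1 / (k : ℝ)) * c⁻¹ ^ (1 / (k : ℝ)) = 1 := by
    rw [← Real.mul_rpow hc.le (inv_nonneg.2 hc.le), mul_inv_cancel₀ hc.ne', Real.one_rpow]
  -- The exponential rate in `L = -log R`: the plateau contributes `β * c⁻¹ ^ (1/k)` and the factor
  -- `R ^ n` costs `n`; positivity is exactly `β > μ_N`.
  set γ : ℝ := β * c⁻¹ ^ (1 / (k : ℝ)) - n with hγdef
  have hγ : 0 < γ := by
    have h1 : 0 < c⁻¹ ^ (1 / (k : ℝ)) := by positivity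
    have h2 := mul_lt_mul_of_pos_right hβ h1
    rw [mul_assoc, hcinv, mul_one] at h2
    linarith
  have hlower : ∀ᶠ L : ℝ in atTop,
      ENNReal.ofReal (n⁻¹ * Real.exp (γ * L)) ≤ moserTrudingerSup (2 * k) k f β := by
    have hlarge : Tendsto (fun L : ℝ => L ^ ((k : ℝ) / (k + 1)) * c⁻¹ ^ (1 / ((k : ℝ) + 1)))
        atTop atTop :=
      (tendsto_rpow_atTop (by positivity)).atTop_mul_const (by positivity)
    filter_upwards [hlarge.eventually_ge_atTop 1, eventually_gt_atTop 0] with L hL1 hL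
    set R : ℝ := Real.exp (-L)
    have hR : 0 < R := Real.exp_pos _
    have hR1 : R < 1 := Real.exp_lt_one_iff.2 (by linarith)
    have hlogR : -Real.log R = L := by simp [R]
    -- Forced by unit norm, since the energy is `A ^ (k + 1) * L`.
    set A : ℝ := (c⁻¹ * L⁻¹) ^ (1 / ((k : ℝ) + 1)) with hAdef
    have hA : 0 ≤ A := by positivity
    have hApow : A ^ (k + 1) = c⁻¹ * L⁻¹ := by
      have : ((k : ℝ) + 1) = ((k + 1 : ℕ) : ℝ) := by push_cast; ring
      rw [hAdef, this, one_div, Real.rpow_inv_natCast_pow (by positivity) (by omega)]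
    have hAL : A * L = L ^ ((k : ℝ) / (k + 1)) * c⁻¹ ^ (1 / ((k : ℝ) + 1)) := by
      have h1 : L⁻¹ ^ (1 / ((k : ℝ) + 1)) * L = L ^ ((k : ℝ) / (k + 1)) := by
        rw [Real.inv_rpow hL.le, ← Real.rpow_neg hL.le]
        nth_rewrite 2 [← Real.rpow_one L]
        rw [← Real.rpow_add hL]
        congr 1
        field_simp
        ring
      rw [hAdef, Real.mul_rpow (by positivity) (by positivity), mul_assoc, h1, mul_comm]
    have hmem : truncatedLog A R ∈ {v : ℝ → ℝ | IsX1 (2 * k) k v ∧ X1norm (2 * k) k v = 1} := by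
      refine ⟨isX1_truncatedLog hNk hA hR hR1, ?_⟩
      rw [X1norm, hNk, energy_truncatedLog hA hR hR1, hlogR, hApow, ← hcdef]
      have : c * (c⁻¹ * L⁻¹ * L) = 1 := by field_simp
      rw [this, Real.one_rpow]
    refine le_trans ?_ (le_iSup₂_of_le (truncatedLog A R) hmem
      (le_expIntegral_truncatedLog hk hf_pos hexp hβ0.le hR hR1 (by rw [hlogR, hAL]; exact hL1)))
    refine ENNReal.ofReal_le_ofReal (le_of_eq ?_)
    rw [hlogR, hAL, rpow_mul_rpow_rpow_conj hk hL.le (by positivity), ← Real.exp_nat_mul,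
      div_mul_eq_mul_div, ← Real.exp_add, ← div_eq_inv_mul]
    congr 2
    rw [hγdef]
    ring
  have hlim : Tendsto (fun L : ℝ => ENNReal.ofReal (n⁻¹ * Real.exp (γ * L))) atTop (𝓝 ⊤) := by
    refine ENNReal.tendsto_ofReal_atTop.comp (Tendsto.const_mul_atTop (inv_pos.2 hn) ?_)
    exact Real.tendsto_exp_atTop.comp (tendsto_id.const_mul_atTop hγ)
  exact top_le_iff.1 (le_of_tendsto hlim hlower)

end Main

theorem proposition1 (N k : ℕ) (hN : 2 ≤ N) (hk : 2 * k = N)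
    (f : ℝ → ℝ) (hf_cont : ContinuousOn f (Set.Ico 0 1)) (hf_zero : f 0 = 0)
    (hf_pos : ∀ r ∈ Set.Ioo (0 : ℝ) 1, 0 < f r)
    (σ : ℝ) (hσ : 1 < σ)
    (hf_limsup : Filter.limsup (fun r : ℝ => ((f r * |Real.log r| ^ σ : ℝ) : EReal))
      (𝓝[>] (0 : ℝ)) < ⊤) :
    (∀ β : ℝ, 0 < β → ∀ v : ℝ → ℝ, IsX1 N k v → expIntegral N f β v < ⊤) ∧
    (∀ β : ℝ, β ≤ criticalConst N k → moserTrudingerSup N k f β < ⊤) ∧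
    (∀ β : ℝ, criticalConst N k < β → moserTrudingerSup N k f β = ⊤) := by
  subst hk
  have hk : 1 ≤ k := by omega
  have hk0 : (0 : ℝ) < k := by exact_mod_cast hk
  have hexp : (((2 * k : ℕ) : ℝ) + 2) / (2 * k : ℕ) = (k + 1 : ℝ) / k := by
    push_cast
    field_simp
  exact ⟨fun β hβ v hv => expIntegral_lt_top hk hf_cont hf_pos hσ hf_limsup hexp hβ hv,
    fun β hβ => moserTrudingerSup_lt_top hk hf_cont hf_pos hσ hf_limsup hexp hβ,
    fun β hβ => moserTrudingerSup_eq_top hk hf_pos hexp hβ⟩
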